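/- Let $|\Psi\rangle_{AB}\in\mathbb C^{a}\otimes\mathbb C^{b}$ be a bipartite pure state with reduced state $\rho_B=\mathrm{Tr}_A|\Psi\rangle\langle\Psi|$. For $\alpha>0$, $\alpha\neq1$, its Rényi entanglement entropy (REE) of order $\alpha$ is $E_\alpha(\Psi)=\frac1{1-\alpha}\log\mathrm{Tr}[\rho_B^\alpha]$, and $E_1(\Psi)=-\mathrm{Tr}[\rho_B\log\rho_B]$. Suppose that an SLOCC protocol (finitely many rounds of local measurements on $A$ or $B$ with finitely many outcomes, each round depending on the previous results through classical communication, and with classical information possibly discarded at the end) transforms $|\Psi\rangle$ into the ensemble of pure states $\{p_m,|\Psi_m\rangle\}$, and write $\langle O\rangle=\sum_m p_m O(\Psi_m)$. Let $\Omega=\{(\alpha,s): 0<\alpha<1,\ s\le 1/\alpha\}\cup\{(\alpha,s):\alpha>1,\ s\ge 1/\alpha\}$. Then for all $0<\alpha\le\gamma$: (i) For every $s$ with $(\alpha,s)\in\Omega$, $$E_\alpha(\Psi)\ \ge\ \frac{1}{s(1-\alpha)}\log\big\langle e^{s(1-\alpha)E_\gamma}\big\rangle ,$$ where for $s=0$ the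 right-hand side denotes its limit $\langle E_\gamma\rangle$ as $s\to0$. (ii) If $\alpha\ne1$, then $(\alpha,1/\alpha)\in\Omega$, and among all $s$ with $(\alpha,s)\in\Omega$ the right-hand side in (i) attains its maximum at $s=1/\alpha$. (iii) If $\alpha=1$, then $E_1(\Psi)\ge\langle E_\gamma\rangle$, the limiting form of the bound as $\alpha\to1$. -/

import Mathlib

open scoped Matrix Kronecker

noncomputable section

namespace SLOCC

/-- A (normalised) pure state of the bipartite system `ℂ^a ⊗ ℂ^b`, given by its amplitudes in the
product basis. -/
structure PureState (a b : ℕ) where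
  amp : Fin a × Fin b → ℂ
  normalized : ∑ x, ‖amp x‖ ^ 2 = 1

/-- The rank-one projector `|Ψ⟩⟨Ψ|`. -/
def PureState.proj {a b : ℕ} (Ψ : PureState a b) :
    Matrix (Fin a × Fin b) (Fin a × Fin b) ℂ :=
  Matrix.vecMulVec Ψ.amp (star Ψ.amp)

/-- The partial trace `Tr_A` over the first factor. -/
def partialTraceA {a b : ℕ} (ρ : Matrix (Fin a × Fin b) (Fin a × Fin b) ℂ) :
    Matrix (Fin b) (Fin b) ℂ :=
  Matrix.of fun j j' => ∑ i, ρ (i, j) (i, j')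

/-- The reduced state `ρ_B = Tr_A |Ψ⟩⟨Ψ|`. -/
def PureState.reducedB {a b : ℕ} (Ψ : PureState a b) : Matrix (Fin b) (Fin b) ℂ :=
  partialTraceA Ψ.proj

/-- The quantum Rényi entropy `S_α(ρ) = (1 - α)⁻¹ log Tr[ρ^α]` of order `α > 0`; at `α = 1` it is
the von Neumann entropy `- Tr[ρ log ρ]`.  Functions of `ρ` are taken in the functional calculus. -/
def renyiEntropy {n : ℕ} (α : ℝ) (ρ : Matrix (Fin n) (Fin n) ℂ) : ℝ :=
  if α = 1 then (cfc Real.negMulLog ρ).trace.re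
  else 1 / (1 - α) * Real.log (cfc (fun x : ℝ => x ^ α) ρ).trace.re

/-- The Rényi entanglement entropy `E_α(Ψ) = S_α(ρ_B)`. -/
def REE {a b : ℕ} (α : ℝ) (Ψ : PureState a b) : ℝ :=
  renyiEntropy α Ψ.reducedB

/-- A finite-round LOCC protocol on `ℂ^a ⊗ ℂ^b` whose final states live on `ℂ^a' ⊗ ℂ^b'` and whose
final outcomes are labelled by elements of `ι`.  In each round one of the parties makes a local
measurement, with Kraus operators `K k` satisfying `∑ k, (K k)ᴴ * K k = 1` (ancillas, unitaries and
the discarding of subsystems are included, as `K k` may change the local dimension), and broadcasts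
the result `k`, on which the rest of the protocol may depend.  Different branches may end
with the same label, so that classical information may be discarded. -/
inductive Protocol (ι : Type*) (a' b' : ℕ) : ℕ → ℕ → Type _
  | done (m : ι) : Protocol ι a' b' a' b'
  | alice {a b : ℕ} (n : ℕ) (d : Fin n → ℕ) (K : ∀ k, Matrix (Fin (d k)) (Fin a) ℂ)
      (hK : ∑ k, (K k)ᴴ * K k = 1) (next : ∀ k, Protocol ι a' b' (d k) b) : Protocol ι a' b' a b
  | bob {a b : ℕ} (n : ℕ) (d : Fin n → ℕ) (K : ∀ k, Matrix (Fin (d k)) (Fin b) ℂ)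
      (hK : ∑ k, (K k)ᴴ * K k = 1) (next : ∀ k, Protocol ι a' b' a (d k)) : Protocol ι a' b' a b

/-- The quantum instrument realised by a protocol: `P.outcome ρ m` is the unnormalised final state
of the outcome `m` on the input `ρ`; its trace is the probability of the outcome `m`. -/
def Protocol.outcome {ι : Type*} [DecidableEq ι] {a' b' : ℕ} : {a b : ℕ} → Protocol ι a' b' a b →
    Matrix (Fin a × Fin b) (Fin a × Fin b) ℂ → ι → Matrix (Fin a' × Fin b') (Fin a' × Fin b') ℂ
  | _, _, .done l, ρ, m => if l = m then ρ else 0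
  | _, b, .alice _ _ K _ next, ρ, m =>
      ∑ k, (next k).outcome
        ((K k ⊗ₖ (1 : Matrix (Fin b) (Fin b) ℂ)) * ρ * (K k ⊗ₖ (1 : Matrix (Fin b) (Fin b) ℂ))ᴴ) m
  | a, _, .bob _ _ K _ next, ρ, m =>
      ∑ k, (next k).outcome
        (((1 : Matrix (Fin a) (Fin a) ℂ) ⊗ₖ K k) * ρ * ((1 : Matrix (Fin a) (Fin a) ℂ) ⊗ₖ K k)ᴴ) m

/-- `Transforms Ψ p Φ`: some SLOCC protocol takes the pure state `Ψ` to the ensemble of pure states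
`{p m, Φ m}`, that is, it yields the outcome `m` with probability `p m`, and then the state `Φ m`. -/
def Transforms {ι : Type*} [DecidableEq ι] {a b a' b' : ℕ} (Ψ : PureState a b) (p : ι → ℝ)
    (Φ : ι → PureState a' b') : Prop :=
  ∃ P : Protocol ι a' b' a b, ∀ m, P.outcome Ψ.proj m = (p m : ℂ) • (Φ m).proj

/-- The mean `⟨x⟩ = ∑ m, p m * x m` over the outcomes. -/
def mean {ι : Type*} [Fintype ι] (p x : ι → ℝ) : ℝ := ∑ m, p m * x m

/-- The set `Ω` of parameters `(α, s)`. -/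
def Omega : Set (ℝ × ℝ) :=
  {q | (0 < q.1 ∧ q.1 < 1 ∧ q.2 ≤ 1 / q.1) ∨ (1 < q.1 ∧ 1 / q.1 ≤ q.2)}

/-- The bound `(1 / (s (1 - α))) log ⟨exp (s (1 - α) x)⟩`; at `s = 0` it denotes
the limit `s → 0`, which is `⟨x⟩`. -/
def entBound {ι : Type*} [Fintype ι] (p x : ι → ℝ) (α s : ℝ) : ℝ :=
  if s = 0 then mean p x
  else 1 / (s * (1 - α)) * Real.log (mean p fun m => Real.exp (s * (1 - α) * x m))

end SLOCC

end

/-! The Schatten quasi-norm `(Tr ρ^α)^(1/α)` is homogeneous of degree one, superadditive on positive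
matrices for `α < 1` and subadditive for `α > 1`. It depends only on the nonzero spectrum, so it
agrees on the two reduced states of a pure state. A measurement by one party splits the other
party's reduced state into a sum, so on average the quasi-norm cannot increase (`α < 1`) or decrease
(`α > 1`): `IsConcaveMonotone.mean_le`. As the quasi-norm equals `exp((1-α)/α * E_α)`, this is the
bound for `s = 1/α`, `γ = α` (`expMean_REE_le`). At `α = 1` a homogeneous form of the entropy takes
its place. The rest follows from `monotone_expMean`: `t⁻¹ log ⟨exp (t x)⟩` is nondecreasing in `t`.
Admissible `s` satisfy `s(1-α) ≤ (1-α)/α`, so `s = 1/α` is best. The Rényi entropy is itself such a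
mean, at `t = 1-α`, whence `E_γ ≤ E_α`. -/

namespace SLOCC

open scoped ComplexOrder

/-! ### Traces of functions of a matrix. -/

/-- The real part of `Tr[f(ρ)]`. -/
noncomputable def traceFun {n : ℕ} (f : ℝ → ℝ) (ρ : Matrix (Fin n) (Fin n) ℂ) : ℝ :=
  (cfc f ρ).trace.re

theorem traceFun_eq_sum {n : ℕ} (f : ℝ → ℝ) {ρ : Matrix (Fin n) (Fin n) ℂ}
    (hρ : ρ.IsHermitian) : traceFun f ρ = ∑ i, f (hρ.eigenvalues i) := by
  rw [traceFun, hρ.cfc_eq, Matrix.IsHermitian.cfc, Unitary.conjStarAlgAut_apply,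
    Matrix.trace_mul_comm, ← mul_assoc]
  simp [Matrix.trace_diagonal]

theorem traceFun_eq_sum_roots {n : ℕ} (f : ℝ → ℝ) {ρ : Matrix (Fin n) (Fin n) ℂ}
    (hρ : ρ.IsHermitian) : traceFun f ρ = (ρ.charpoly.roots.map fun z => f z.re).sum := by
  rw [traceFun_eq_sum f hρ, hρ.roots_charpoly_eq_eigenvalues]
  simp [Finset.sum]
  rfl

/-- The two characteristic polynomials agree up to powers of `X`, and `f 0 = 0` makes the extra zero
roots harmless. -/
theorem traceFun_mul_conjTranspose_comm {m n : ℕ} {f : ℝ → ℝ} (hf : f 0 = 0)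
    (W : Matrix (Fin m) (Fin n) ℂ) : traceFun f (W * Wᴴ) = traceFun f (Wᴴ * W) := by
  rw [traceFun_eq_sum_roots f (Matrix.isHermitian_mul_conjTranspose_self W),
    traceFun_eq_sum_roots f (Matrix.isHermitian_conjTranspose_mul_self W)]
  have h := congrArg (fun q : Polynomial ℂ => (q.roots.map fun z => f z.re).sum)
    (Matrix.charpoly_mul_comm' W Wᴴ)
  have hX (k : ℕ) : (Polynomial.X ^ k : Polynomial ℂ) ≠ 0 := pow_ne_zero _ Polynomial.X_ne_zero
  simpa [Polynomial.roots_mul, hX, (Matrix.charpoly_monic _).ne_zero, Multiset.map_nsmul,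
    Multiset.sum_nsmul, hf] using h

theorem traceFun_smul {n : ℕ} (f : ℝ → ℝ) (c : ℝ) {ρ : Matrix (Fin n) (Fin n) ℂ}
    (hρ : ρ.IsHermitian) : traceFun f ((c : ℂ) • ρ) = traceFun (fun x => f (c * x)) ρ := by
  rw [traceFun, traceFun, cfc_comp_const_mul c f ρ
    ((ρ.finite_real_spectrum.image _).continuousOn _) hρ.isSelfAdjoint, Complex.coe_smul]

theorem trace_re_eq_sum_eigenvalues {n : ℕ} {ρ : Matrix (Fin n) (Fin n) ℂ}
    (hρ : ρ.IsHermitian) : ρ.trace.re = ∑ i, hρ.eigenvalues i := by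
  simp [hρ.trace_eq_sum_eigenvalues]

/-- Peierls' inequality: passing to the diagonal in an arbitrary orthonormal basis increases the
trace of a concave function. -/
theorem traceFun_le_sum_diag {n : ℕ} {f : ℝ → ℝ} (hf : ConcaveOn ℝ (Set.Ici 0) f)
    {ρ : Matrix (Fin n) (Fin n) ℂ} (hρ : ρ.PosSemidef) (U : Matrix.unitaryGroup (Fin n) ℂ) :
    traceFun f ρ ≤ ∑ i, f (((star U : Matrix (Fin n) (Fin n) ℂ) * ρ * U) i i).re := by
  set lam := hρ.isHermitian.eigenvalues
  set Q : Matrix.unitaryGroup (Fin n) ℂ := star U * hρ.isHermitian.eigenvectorUnitary with hQ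
  have hdiag : (star U : Matrix (Fin n) (Fin n) ℂ) * ρ * U =
      (Q : Matrix (Fin n) (Fin n) ℂ) * Matrix.diagonal (fun j => (lam j : ℂ)) *
        star (Q : Matrix (Fin n) (Fin n) ℂ) := by
    conv_lhs => rw [hρ.isHermitian.spectral_theorem, Unitary.conjStarAlgAut_apply]
    simp only [hQ, Submonoid.coe_mul, Unitary.coe_star, star_mul, star_star, mul_assoc]
    rfl
  have hentry (i : Fin n) : (((star U : Matrix (Fin n) (Fin n) ℂ) * ρ * U) i i).re =
      ∑ j, Complex.normSq (Q.1 i j) * lam j := by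
    rw [hdiag, Matrix.mul_apply, Complex.re_sum]
    refine Finset.sum_congr rfl fun j _ => ?_
    simp only [Matrix.mul_diagonal, Matrix.star_apply, Complex.normSq_apply, Complex.mul_re,
      Complex.mul_im, Complex.ofReal_re, Complex.ofReal_im, RCLike.star_def, Complex.conj_re,
      Complex.conj_im]
    ring
  -- The matrix of `|Q i j|²` is doubly stochastic: row sums allow Jensen's inequality, column sums
  -- recover `∑ f (lam j)`.
  have hrow (i : Fin n) : ∑ j, Complex.normSq (Q.1 i j) = 1 := by
    have h := congrArg (fun A : Matrix (Fin n) (Fin n) ℂ => (A i i).re) (Unitary.coe_mul_star_self Q)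
    simpa [Matrix.mul_apply, Matrix.star_apply, Complex.normSq_apply] using h
  have hcol (j : Fin n) : ∑ i, Complex.normSq (Q.1 i j) = 1 := by
    have h := congrArg (fun A : Matrix (Fin n) (Fin n) ℂ => (A j j).re) (Unitary.coe_star_mul_self Q)
    simpa [Matrix.mul_apply, Matrix.star_apply, Complex.normSq_apply] using h
  rw [traceFun_eq_sum f hρ.isHermitian]
  calc ∑ j, f (lam j) = ∑ j, ∑ i, Complex.normSq (Q.1 i j) * f (lam j) := by
        simp [← Finset.sum_mul, hcol]
    _ = ∑ i, ∑ j, Complex.normSq (Q.1 i j) • f (lam j) := by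
        rw [Finset.sum_comm]; simp
    _ ≤ ∑ i, f (∑ j, Complex.normSq (Q.1 i j) • lam j) :=
        Finset.sum_le_sum fun i _ => hf.le_map_sum (fun j _ => Complex.normSq_nonneg _) (hrow i)
          fun j _ => hρ.eigenvalues_nonneg j
    _ = _ := by simp [hentry]

/-- The diagonals of `ρ` and `σ` in an eigenbasis of `ρ + σ`. -/
theorem exists_diag_add {n : ℕ} {ρ σ : Matrix (Fin n) (Fin n) ℂ} (hρ : ρ.PosSemidef)
    (hσ : σ.PosSemidef) : ∃ x y : Fin n → ℝ, (∀ i, 0 ≤ x i) ∧ (∀ i, 0 ≤ y i) ∧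
      (∑ i, x i = ρ.trace.re) ∧ (∑ i, y i = σ.trace.re) ∧
      (∀ f, traceFun f (ρ + σ) = ∑ i, f (x i + y i)) ∧
      ∀ f, ConcaveOn ℝ (Set.Ici 0) f →
        traceFun f ρ ≤ ∑ i, f (x i) ∧ traceFun f σ ≤ ∑ i, f (y i) := by
  have h := (hρ.add hσ).isHermitian
  -- In this basis the trace for `ρ + σ` is exact and Peierls' inequality handles `ρ` and `σ`, which
  -- reduces superadditivity to nonnegative vectors.
  set U : Matrix.unitaryGroup (Fin n) ℂ := h.eigenvectorUnitary
  have hpos {τ : Matrix (Fin n) (Fin n) ℂ} (hτ : τ.PosSemidef) (i : Fin n) :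
      0 ≤ (((star U : Matrix (Fin n) (Fin n) ℂ) * τ * U) i i).re :=
    (Complex.le_def.1 (hτ.conjTranspose_mul_mul_same (U : Matrix (Fin n) (Fin n) ℂ)).diag_nonneg).1
  have htr (τ : Matrix (Fin n) (Fin n) ℂ) :
      ∑ i, (((star U : Matrix (Fin n) (Fin n) ℂ) * τ * U) i i).re = τ.trace.re := by
    rw [← Complex.re_sum]
    change (Matrix.trace (star U.1 * τ * U.1)).re = _
    rw [Matrix.trace_mul_comm, ← mul_assoc, Unitary.mul_star_self_of_mem U.2, one_mul]
  refine ⟨_, _, hpos hρ, hpos hσ, htr ρ, htr σ, fun f => ?_, fun f hf =>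
    ⟨traceFun_le_sum_diag hf hρ U, traceFun_le_sum_diag hf hσ U⟩⟩
  rw [traceFun_eq_sum f h]
  refine Finset.sum_congr rfl fun i _ => congrArg f ?_
  have h2 := congrArg (fun A : Matrix (Fin n) (Fin n) ℂ => (A i i).re)
    h.conjStarAlgAut_star_eigenvectorUnitary
  rw [Unitary.conjStarAlgAut_star_apply] at h2
  rw [← Complex.add_re, ← Matrix.add_apply, ← add_mul, ← mul_add]
  simpa using h2.symm

/-! ### Reduced states and monotonicity along a protocol. -/

section Protocols

variable {a b a' b' : ℕ}

/-- The amplitudes of a vector of `ℂ^a ⊗ ℂ^b`, as a `b × a` matrix. -/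
def ampMatrix (ψ : Fin a × Fin b → ℂ) : Matrix (Fin b) (Fin a) ℂ :=
  Matrix.of fun j i => ψ (i, j)

/-- For the amplitude matrix `W`, `W * Wᴴ` is the reduced state of B and `Wᴴ * W` the transpose of
that of A. -/
theorem partialTraceA_vecMulVec (ψ : Fin a × Fin b → ℂ) :
    partialTraceA (Matrix.vecMulVec ψ (star ψ)) = ampMatrix ψ * (ampMatrix ψ)ᴴ := by
  ext j j'
  simp [partialTraceA, ampMatrix, Matrix.mul_apply, Matrix.vecMulVec_apply]

theorem partialTraceA_smul (c : ℂ) (ρ : Matrix (Fin a × Fin b) (Fin a × Fin b) ℂ) :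
    partialTraceA (c • ρ) = c • partialTraceA ρ := by
  ext j j'
  simp [partialTraceA, Finset.mul_sum]

theorem trace_partialTraceA (ρ : Matrix (Fin a × Fin b) (Fin a × Fin b) ℂ) :
    (partialTraceA ρ).trace = ρ.trace := by
  simp only [Matrix.trace, partialTraceA, Matrix.diag_apply, Matrix.of_apply, Fintype.sum_prod_type]
  rw [Finset.sum_comm]

theorem ampMatrix_kronecker_one_mulVec {d : ℕ} (K : Matrix (Fin d) (Fin a) ℂ)
    (ψ : Fin a × Fin b → ℂ) :
    ampMatrix ((K ⊗ₖ (1 : Matrix (Fin b) (Fin b) ℂ)) *ᵥ ψ) = ampMatrix ψ * Kᵀ := by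
  ext j i
  simp [ampMatrix, Matrix.mul_apply, Matrix.mulVec, dotProduct, Fintype.sum_prod_type,
    Matrix.kroneckerMap_apply, Matrix.one_apply, mul_comm]

theorem ampMatrix_one_kronecker_mulVec {d : ℕ} (K : Matrix (Fin d) (Fin b) ℂ)
    (ψ : Fin a × Fin b → ℂ) :
    ampMatrix (((1 : Matrix (Fin a) (Fin a) ℂ) ⊗ₖ K) *ᵥ ψ) = K * ampMatrix ψ := by
  ext j i
  simp [ampMatrix, Matrix.mul_apply, Matrix.mulVec, dotProduct, Fintype.sum_prod_type,
    Matrix.kroneckerMap_apply, Matrix.one_apply]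

theorem mul_vecMulVec_star_mul_conjTranspose {m n : Type*} [Fintype n] (K : Matrix m n ℂ)
    (ψ : n → ℂ) :
    K * Matrix.vecMulVec ψ (star ψ) * Kᴴ = Matrix.vecMulVec (K *ᵥ ψ) (star (K *ᵥ ψ)) := by
  rw [Matrix.mul_vecMulVec, Matrix.vecMulVec_mul, Matrix.star_mulVec]

theorem PureState.dotProduct_star_amp (Ψ : PureState a b) : star Ψ.amp ⬝ᵥ Ψ.amp = 1 := by
  have h : ((∑ x, ‖Ψ.amp x‖ ^ 2 : ℝ) : ℂ) = 1 := by rw [Ψ.normalized]; simp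
  rw [← h]
  simp [dotProduct, Complex.conj_mul']

theorem PureState.trace_proj (Ψ : PureState a b) : Ψ.proj.trace = 1 := by
  rw [PureState.proj, Matrix.trace_vecMulVec, dotProduct_comm, Ψ.dotProduct_star_amp]

theorem PureState.trace_reducedB (Ψ : PureState a b) : Ψ.reducedB.trace = 1 := by
  rw [PureState.reducedB, trace_partialTraceA, Ψ.trace_proj]

theorem PureState.posSemidef_reducedB (Ψ : PureState a b) : Ψ.reducedB.PosSemidef := by
  rw [PureState.reducedB, PureState.proj, partialTraceA_vecMulVec]
  exact Matrix.posSemidef_self_mul_conjTranspose _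

/-- A positive semidefinite matrix that vanishes on the orthogonal complement of the unit vector
`v` is a nonnegative multiple of the projector onto `v`. -/
theorem eq_smul_vecMulVec_of_mulVec_eq_zero {n : Type*} [Fintype n] {A : Matrix n n ℂ} {v : n → ℂ}
    (hA : A.PosSemidef) (hv : star v ⬝ᵥ v = 1) (h : ∀ x, star v ⬝ᵥ x = 0 → A *ᵥ x = 0) :
    ∃ q : ℝ, 0 ≤ q ∧ A = (q : ℂ) • Matrix.vecMulVec v (star v) := by
  classical
  have h1 : A = A * Matrix.vecMulVec v (star v) := by
    refine Matrix.ext_of_mulVec_single fun i => ?_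
    -- The test vector is the component of the basis vector orthogonal to `v`.
    have h2 := h (Pi.single i 1 - (star v ⬝ᵥ Pi.single i 1) • v) (by
      rw [dotProduct_sub, dotProduct_smul, hv]; simp)
    rw [Matrix.mulVec_sub, sub_eq_zero] at h2
    rw [h2, ← Matrix.mulVec_mulVec, Matrix.vecMulVec_mulVec]
    simp
  have h3 : A = Matrix.vecMulVec v (star v) * A := by
    have h4 := congrArg Matrix.conjTranspose h1
    rwa [Matrix.conjTranspose_mul, hA.isHermitian.eq, Matrix.conjTranspose_vecMulVec,
      star_star] at h4
  have hq := Complex.le_def.1 (hA.dotProduct_mulVec_nonneg v)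
  refine ⟨(star v ⬝ᵥ A *ᵥ v).re, hq.1, ?_⟩
  have hq' : ((star v ⬝ᵥ A *ᵥ v).re : ℂ) = star v ⬝ᵥ A *ᵥ v :=
    Complex.ext rfl (by simpa using hq.2)
  rw [hq']
  conv_lhs => rw [h3, h1]
  rw [Matrix.mul_vecMulVec, Matrix.vecMulVec_mul_vecMulVec, Matrix.vecMulVec_smul]

/-- A pure state is extremal: if positive semidefinite matrices sum to a multiple of its projector,
then each is such a multiple. -/
theorem PureState.exists_smul_proj {κ : Type*} [Fintype κ] (Ψ : PureState a b)
    {A : κ → Matrix (Fin a × Fin b) (Fin a × Fin b) ℂ} (hA : ∀ k, (A k).PosSemidef) {c : ℂ}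
    (h : ∑ k, A k = c • Ψ.proj) (k : κ) : ∃ q : ℝ, 0 ≤ q ∧ A k = (q : ℂ) • Ψ.proj := by
  refine eq_smul_vecMulVec_of_mulVec_eq_zero (hA k) Ψ.dotProduct_star_amp fun x hx => ?_
  have h0 : ∑ k, star x ⬝ᵥ A k *ᵥ x = 0 := by
    rw [← dotProduct_sum, ← Matrix.sum_mulVec, h, Matrix.smul_mulVec, PureState.proj,
      Matrix.vecMulVec_mulVec, hx]
    simp
  rw [Finset.sum_eq_zero_iff_of_nonneg fun k _ => (hA k).dotProduct_mulVec_nonneg x] at h0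
  exact ((hA k).dotProduct_mulVec_zero_iff x).1 (h0 k (Finset.mem_univ k))

theorem Protocol.posSemidef_outcome {ι : Type*} [DecidableEq ι] (P : Protocol ι a' b' a b)
    {ρ : Matrix (Fin a × Fin b) (Fin a × Fin b) ℂ} (hρ : ρ.PosSemidef) (m : ι) :
    (P.outcome ρ m).PosSemidef := by
  induction P with
  | done l =>
    rw [Protocol.outcome]
    split_ifs
    exacts [hρ, .zero]
  | alice n d K hK next ih =>
    rw [Protocol.outcome]
    exact Matrix.posSemidef_sum _ fun k _ => ih k (hρ.mul_mul_conjTranspose_same _)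
  | bob n d K hK next ih =>
    rw [Protocol.outcome]
    exact Matrix.posSemidef_sum _ fun k _ => ih k (hρ.mul_mul_conjTranspose_same _)

/-- A functional of (unnormalised) density matrices which is homogeneous, superadditive, and takes
the same value on both reduced states of a pure state. -/
structure IsConcaveMonotone (N : ∀ n : ℕ, Matrix (Fin n) (Fin n) ℂ → ℝ) : Prop where
  smul : ∀ {n : ℕ} {c : ℝ} {ρ : Matrix (Fin n) (Fin n) ℂ}, 0 ≤ c → ρ.PosSemidef →
    N n ((c : ℂ) • ρ) = c * N n ρ
  add : ∀ {n : ℕ} {ρ σ : Matrix (Fin n) (Fin n) ℂ}, ρ.PosSemidef → σ.PosSemidef →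
    N n ρ + N n σ ≤ N n (ρ + σ)
  comm : ∀ {m n : ℕ} (W : Matrix (Fin m) (Fin n) ℂ), N m (W * Wᴴ) = N n (Wᴴ * W)

namespace IsConcaveMonotone

variable {N : ∀ n : ℕ, Matrix (Fin n) (Fin n) ℂ → ℝ}

theorem sum_le (hN : IsConcaveMonotone N) {κ : Type*} {n : ℕ} (s : Finset κ)
    {ρ : κ → Matrix (Fin n) (Fin n) ℂ} (hρ : ∀ k, (ρ k).PosSemidef) :
    ∑ k ∈ s, N n (ρ k) ≤ N n (∑ k ∈ s, ρ k) := by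
  classical
  induction s using Finset.induction_on with
  | empty =>
    have h := hN.smul (n := n) (c := 0) (ρ := 0) le_rfl .zero
    simp only [smul_zero, zero_mul] at h
    simp [h]
  | insert k s hk ih =>
    rw [Finset.sum_insert hk, Finset.sum_insert hk]
    exact (add_le_add_right ih _).trans
      (hN.add (hρ k) (Matrix.posSemidef_sum _ fun k _ => hρ k))

/-- Alice's measurement preserves Bob's reduced state on average, so superadditivity applies. -/
theorem sum_alice_le (hN : IsConcaveMonotone N) {n : ℕ} {d : Fin n → ℕ}
    (K : ∀ k, Matrix (Fin (d k)) (Fin a) ℂ) (hK : ∑ k, (K k)ᴴ * K k = 1)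
    (W : Matrix (Fin b) (Fin a) ℂ) :
    ∑ k, N b ((W * (K k)ᵀ) * (W * (K k)ᵀ)ᴴ) ≤ N b (W * Wᴴ) := by
  refine (hN.sum_le _ fun k => Matrix.posSemidef_self_mul_conjTranspose _).trans_eq ?_
  congr 1
  have h : ∑ k, (K k)ᵀ * ((K k)ᵀ)ᴴ = 1 := by
    have h2 := congrArg Matrix.transpose hK
    rw [Matrix.transpose_sum, Matrix.transpose_one] at h2
    rw [← h2]
    simp [Matrix.transpose_mul, Matrix.conjTranspose, Matrix.transpose_map]
  calc _ = W * (∑ k, (K k)ᵀ * ((K k)ᵀ)ᴴ) * Wᴴ := by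
        simp only [Matrix.conjTranspose_mul, Matrix.mul_sum, Matrix.sum_mul, Matrix.mul_assoc]
    _ = _ := by rw [h, Matrix.mul_one]

/-- Bob's measurement changes his own state but preserves Alice's on average; `comm` passes to her
side, whose dimension is the same for all `k`. -/
theorem sum_bob_le (hN : IsConcaveMonotone N) {n : ℕ} {d : Fin n → ℕ}
    (K : ∀ k, Matrix (Fin (d k)) (Fin b) ℂ) (hK : ∑ k, (K k)ᴴ * K k = 1)
    (W : Matrix (Fin b) (Fin a) ℂ) :
    ∑ k, N (d k) ((K k * W) * (K k * W)ᴴ) ≤ N b (W * Wᴴ) := by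
  simp only [hN.comm]
  refine (hN.sum_le _ fun k => Matrix.posSemidef_conjTranspose_mul_self _).trans_eq ?_
  congr 1
  calc _ = Wᴴ * (∑ k, (K k)ᴴ * K k) * W := by
        simp only [Matrix.conjTranspose_mul, Matrix.mul_sum, Matrix.sum_mul, Matrix.mul_assoc]
    _ = _ := by rw [hK, Matrix.mul_one]

theorem sum_outcome_le (hN : IsConcaveMonotone N) {ι : Type*} [Fintype ι] [DecidableEq ι]
    (Φ : ι → PureState a' b') (P : Protocol ι a' b' a b) (ψ : Fin a × Fin b → ℂ) (p : ι → ℝ)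
    (hp : ∀ m, 0 ≤ p m)
    (h : ∀ m, P.outcome (Matrix.vecMulVec ψ (star ψ)) m = (p m : ℂ) • (Φ m).proj) :
    ∑ m, p m * N b' (Φ m).reducedB ≤ N b (partialTraceA (Matrix.vecMulVec ψ (star ψ))) := by
  -- Branches may share a label. As `Φ m` is pure, each branch contributes a multiple of its
  -- projector, so the induction hypothesis applies to each branch with its own weights.
  have hpart {n : ℕ} {A : Fin n → ι → Matrix (Fin a' × Fin b') (Fin a' × Fin b') ℂ} {p : ι → ℝ}
      (hA : ∀ k m, (A k m).PosSemidef) (h : ∀ m, ∑ k, A k m = (p m : ℂ) • (Φ m).proj) :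
      ∃ q : Fin n → ι → ℝ, (∀ k m, 0 ≤ q k m) ∧ (∀ k m, A k m = (q k m : ℂ) • (Φ m).proj) ∧
        ∀ m, ∑ k, q k m = p m := by
    choose q hq hqA using fun k m => (Φ m).exists_smul_proj (fun k => hA k m) (h m) k
    refine ⟨q, hq, hqA, fun m => ?_⟩
    have ht := congrArg Matrix.trace (h m)
    simp only [hqA, Matrix.trace_sum, Matrix.trace_smul, PureState.trace_proj, smul_eq_mul,
      mul_one] at ht
    exact_mod_cast ht
  induction P generalizing p with
  | done l =>
    have hl := h l
    simp only [Protocol.outcome, if_true] at hl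
    have hne : ∀ m, m ≠ l → p m = 0 := fun m hm => by
      have h2 := congrArg Matrix.trace (h m)
      simpa [Protocol.outcome, hm.symm, PureState.trace_proj] using h2.symm
    rw [Finset.sum_eq_single l (fun m _ hm => by simp [hne m hm]) (by simp), hl,
      partialTraceA_smul]
    exact (hN.smul (hp l) (Φ l).posSemidef_reducedB).ge
  | alice n d K hK next ih =>
    simp only [Protocol.outcome, mul_vecMulVec_star_mul_conjTranspose] at h
    obtain ⟨q, hq, hqA, hqp⟩ := hpart (fun k m => (next k).posSemidef_outcome
      (Matrix.posSemidef_vecMulVec_self_star _) m) h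
    calc _ = ∑ k, ∑ m, q k m * N b' (Φ m).reducedB := by
          rw [Finset.sum_comm]
          simp only [← hqp, Finset.sum_mul]
      _ ≤ _ := Finset.sum_le_sum fun k _ => ih k _ (q k) (hq k) (hqA k)
      _ ≤ _ := by
          simp only [partialTraceA_vecMulVec, ampMatrix_kronecker_one_mulVec]
          exact hN.sum_alice_le K hK _
  | bob n d K hK next ih =>
    simp only [Protocol.outcome, mul_vecMulVec_star_mul_conjTranspose] at h
    obtain ⟨q, hq, hqA, hqp⟩ := hpart (fun k m => (next k).posSemidef_outcome
      (Matrix.posSemidef_vecMulVec_self_star _) m) h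
    calc _ = ∑ k, ∑ m, q k m * N b' (Φ m).reducedB := by
          rw [Finset.sum_comm]
          simp only [← hqp, Finset.sum_mul]
      _ ≤ _ := Finset.sum_le_sum fun k _ => ih k _ (q k) (hq k) (hqA k)
      _ ≤ _ := by
          simp only [partialTraceA_vecMulVec, ampMatrix_one_kronecker_mulVec]
          exact hN.sum_bob_le K hK _

end IsConcaveMonotone

section Transforms

variable {ι : Type*} [DecidableEq ι] {Ψ : PureState a b} {p : ι → ℝ} {Φ : ι → PureState a' b'}

theorem Transforms.nonneg (h : Transforms Ψ p Φ) (m : ι) : 0 ≤ p m := by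
  obtain ⟨P, hP⟩ := h
  have h1 := (P.posSemidef_outcome (Matrix.posSemidef_vecMulVec_self_star Ψ.amp) m).trace_nonneg
  have h2 := congrArg Matrix.trace (hP m)
  rw [Matrix.trace_smul, PureState.trace_proj] at h2
  rw [PureState.proj] at h2
  rw [h2] at h1
  simpa using h1

theorem IsConcaveMonotone.mean_le [Fintype ι] {N : ∀ n : ℕ, Matrix (Fin n) (Fin n) ℂ → ℝ}
    (hN : IsConcaveMonotone N) (h : Transforms Ψ p Φ) :
    mean p (fun m => N b' (Φ m).reducedB) ≤ N b Ψ.reducedB :=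
  let ⟨P, hP⟩ := h
  hN.sum_outcome_le Φ P Ψ.amp p h.nonneg hP

theorem isConcaveMonotone_mul_trace (ε : ℝ) :
    IsConcaveMonotone fun _ ρ => ε * ρ.trace.re where
  smul _ _ := by simp [Matrix.trace_smul]; ring
  add _ _ := by simp [Matrix.trace_add, mul_add]
  comm W := by rw [Matrix.trace_mul_comm]

/-- The trace and its negative are both concave monotones, which bounds the total probability from
both sides. -/
theorem Transforms.sum_eq_one [Fintype ι] (h : Transforms Ψ p Φ) : ∑ m, p m = 1 := by
  have h1 := (isConcaveMonotone_mul_trace 1).mean_le h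
  have h2 := (isConcaveMonotone_mul_trace (-1)).mean_le h
  simp only [mean, PureState.trace_reducedB, Complex.one_re, mul_one, Finset.sum_neg_distrib,
    mul_neg] at h1 h2
  linarith

end Transforms

end Protocols

/-! ### Monotonicity of exponential means. -/

section ExponentialMean

variable {ι : Type*} [Fintype ι] {p x y : ι → ℝ}

/-- The exponential mean `t⁻¹ log ⟨exp (t x)⟩`, which is `⟨x⟩` at `t = 0`. -/
noncomputable def expMean (p x : ι → ℝ) (t : ℝ) : ℝ :=
  if t = 0 then mean p x else 1 / t * Real.log (mean p fun m => Real.exp (t * x m))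

theorem expMean_zero : expMean p x 0 = mean p x := if_pos rfl

theorem expMean_of_ne {t : ℝ} (ht : t ≠ 0) :
    expMean p x t = 1 / t * Real.log (mean p fun m => Real.exp (t * x m)) := if_neg ht

theorem entBound_eq_expMean {α : ℝ} (hα : α ≠ 1) (s : ℝ) :
    entBound p x α s = expMean p x (s * (1 - α)) := by
  have : 1 - α ≠ 0 := sub_ne_zero.2 hα.symm
  simp [entBound, expMean, this]

theorem mean_mono (hp : ∀ m, 0 ≤ p m) (hxy : ∀ m, x m ≤ y m) : mean p x ≤ mean p y :=
  Finset.sum_le_sum fun m _ => mul_le_mul_of_nonneg_left (hxy m) (hp m)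

theorem mean_pos (hp : ∀ m, 0 ≤ p m) (hp1 : ∑ m, p m = 1) (hx : ∀ m, 0 < x m) :
    0 < mean p x := by
  have h0 : ∀ m ∈ Finset.univ, 0 ≤ p m * x m := fun m _ => mul_nonneg (hp m) (hx m).le
  refine (Finset.sum_nonneg h0).lt_of_ne fun h => ?_
  have h2 := (Finset.sum_eq_zero_iff_of_nonneg h0).1 h.symm
  have h3 : ∀ m, p m = 0 := fun m =>
    (mul_eq_zero.1 (h2 m (Finset.mem_univ m))).resolve_right (hx m).ne'
  simp [h3] at hp1

theorem expMean_mono (hp : ∀ m, 0 ≤ p m) (hp1 : ∑ m, p m = 1) (hxy : ∀ m, x m ≤ y m) (t : ℝ) :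
    expMean p x t ≤ expMean p y t := by
  have hpos (z : ι → ℝ) := mean_pos hp hp1 fun m => Real.exp_pos (t * z m)
  rcases lt_trichotomy t 0 with ht | rfl | ht
  · rw [expMean_of_ne ht.ne, expMean_of_ne ht.ne]
    refine mul_le_mul_of_nonpos_left (Real.log_le_log (hpos y) (mean_mono hp fun m => ?_))
      (one_div_neg.2 ht).le
    exact Real.exp_le_exp.2 (mul_le_mul_of_nonpos_left (hxy m) ht.le)
  · simpa only [expMean_zero] using mean_mono hp hxy
  · rw [expMean_of_ne ht.ne', expMean_of_ne ht.ne']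
    refine mul_le_mul_of_nonneg_left (Real.log_le_log (hpos x) (mean_mono hp fun m => ?_))
      (one_div_pos.2 ht).le
    exact Real.exp_le_exp.2 (mul_le_mul_of_nonneg_left (hxy m) ht.le)

/-- This reflection transfers monotonicity from positive to negative parameters. -/
theorem expMean_neg (t : ℝ) : expMean p (fun m => -x m) (-t) = -expMean p x t := by
  by_cases ht : t = 0
  · simp [ht, expMean_zero, mean]
  · rw [expMean_of_ne ht, expMean_of_ne (neg_ne_zero.2 ht)]
    simp

theorem expMean_zero_le (hp : ∀ m, 0 ≤ p m) (hp1 : ∑ m, p m = 1) {t : ℝ} (ht : 0 ≤ t) :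
    expMean p x 0 ≤ expMean p x t := by
  rcases ht.eq_or_lt with rfl | ht
  · rfl
  rw [expMean_zero, expMean_of_ne ht.ne', one_div, ← div_eq_inv_mul, le_div_iff₀ ht,
    Real.le_log_iff_exp_le (mean_pos hp hp1 fun m => Real.exp_pos _)]
  have h := convexOn_exp.map_sum_le (t := Finset.univ) (w := p) (p := fun m => t * x m)
    (fun m _ => hp m) hp1 (by simp)
  simp only [smul_eq_mul] at h
  refine Eq.trans_le (congrArg Real.exp ?_) h
  rw [mean, Finset.sum_mul]
  exact Finset.sum_congr rfl fun m _ => by ring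

/-- The power mean inequality for the values `exp (t * x m)` with exponent `u / t ≥ 1`. -/
theorem expMean_le_of_pos (hp : ∀ m, 0 ≤ p m) (hp1 : ∑ m, p m = 1) {t u : ℝ} (ht : 0 < t)
    (htu : t ≤ u) : expMean p x t ≤ expMean p x u := by
  have hu := ht.trans_le htu
  have hpos (z : ℝ) := mean_pos hp hp1 fun m => Real.exp_pos (z * x m)
  have h := Real.rpow_arith_mean_le_arith_mean_rpow Finset.univ p (fun m => Real.exp (t * x m))
    (fun m _ => hp m) hp1 (fun m _ => (Real.exp_pos _).le) ((one_le_div ht).2 htu)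
  have hexp (m : ι) : Real.exp (t * x m) ^ (u / t) = Real.exp (u * x m) := by
    rw [← Real.exp_mul]
    congr 1
    field_simp
  simp only [hexp] at h
  have h2 := Real.log_le_log (Real.rpow_pos_of_pos (hpos t) _) h
  rw [Real.log_rpow (hpos t)] at h2
  rw [expMean_of_ne ht.ne', expMean_of_ne hu.ne', one_div, one_div, ← div_eq_inv_mul,
    ← div_eq_inv_mul, div_le_div_iff₀ ht hu]
  rw [div_mul_eq_mul_div, div_le_iff₀ ht, mul_comm u] at h2
  exact h2

theorem monotone_expMean (hp : ∀ m, 0 ≤ p m) (hp1 : ∑ m, p m = 1) : Monotone (expMean p x) := by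
  intro t u htu
  rcases lt_or_ge 0 t with ht | ht
  · exact expMean_le_of_pos hp hp1 ht htu
  rcases lt_or_ge u 0 with hu | hu
  · have h := expMean_le_of_pos (x := fun m => -x m) hp hp1 (neg_pos.2 hu) (neg_le_neg htu)
    rw [expMean_neg, expMean_neg] at h
    exact neg_le_neg_iff.1 h
  · refine le_trans ?_ (expMean_zero_le hp hp1 hu)
    have h := expMean_zero_le (x := fun m => -x m) hp hp1 (neg_nonneg.2 ht)
    rw [← neg_zero, expMean_neg, expMean_neg, neg_le_neg_iff] at h
    exact h

end ExponentialMean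

/-! ### Rényi entropies as exponential means of the spectrum. -/

section Renyi

variable {a b : ℕ}

/-- The eigenvalues serve as weights: `λ^α = λ * exp ((1-α) * (-log λ))`. At `λ = 0` both sides
vanish because `α > 0`. -/
theorem renyiEntropy_eq_expMean {n : ℕ} {ρ : Matrix (Fin n) (Fin n) ℂ} (hρ : ρ.PosSemidef)
    {α : ℝ} (hα : 0 < α) : renyiEntropy α ρ =
      expMean hρ.isHermitian.eigenvalues (fun i => -Real.log (hρ.isHermitian.eigenvalues i))
        (1 - α) := by
  by_cases h1 : α = 1
  · rw [renyiEntropy, if_pos h1, h1, sub_self, expMean_zero]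
    refine (traceFun_eq_sum _ hρ.isHermitian).trans (Finset.sum_congr rfl fun i _ => ?_)
    rw [Real.negMulLog]
    ring
  · rw [renyiEntropy, if_neg h1, expMean_of_ne (sub_ne_zero.2 (Ne.symm h1))]
    congr 2
    refine (traceFun_eq_sum _ hρ.isHermitian).trans (Finset.sum_congr rfl fun i _ => ?_)
    rcases (hρ.eigenvalues_nonneg i).eq_or_lt with h0 | h0
    · rw [← h0, Real.zero_rpow hα.ne', zero_mul]
    · rw [Real.rpow_def_of_pos h0]
      nth_rewrite 2 [← Real.exp_log h0]
      rw [← Real.exp_add]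
      congr 1
      ring

theorem PureState.sum_eigenvalues (Ψ : PureState a b) :
    ∑ i, Ψ.posSemidef_reducedB.isHermitian.eigenvalues i = 1 := by
  rw [← trace_re_eq_sum_eigenvalues, Ψ.trace_reducedB, Complex.one_re]

theorem REE_anti (Ψ : PureState a b) {α γ : ℝ} (hα : 0 < α) (hαγ : α ≤ γ) :
    REE γ Ψ ≤ REE α Ψ := by
  rw [REE, REE, renyiEntropy_eq_expMean Ψ.posSemidef_reducedB hα,
    renyiEntropy_eq_expMean Ψ.posSemidef_reducedB (hα.trans_le hαγ)]
  exact monotone_expMean Ψ.posSemidef_reducedB.eigenvalues_nonneg Ψ.sum_eigenvalues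
    (sub_le_sub_left hαγ 1)

end Renyi

/-! ### Schatten quasi-norms and homogeneous entropy as concave monotones. -/

section Monotones

/-- The Schatten (quasi-)norm `(Tr ρ^α)^(1/α)` of a positive semidefinite matrix. -/
noncomputable def schatten {n : ℕ} (α : ℝ) (ρ : Matrix (Fin n) (Fin n) ℂ) : ℝ :=
  traceFun (fun x => x ^ α) ρ ^ (1 / α)

theorem traceFun_rpow_nonneg {n : ℕ} (α : ℝ) {ρ : Matrix (Fin n) (Fin n) ℂ}
    (hρ : ρ.PosSemidef) : 0 ≤ traceFun (fun x => x ^ α) ρ := by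
  rw [traceFun_eq_sum _ hρ.isHermitian]
  exact Finset.sum_nonneg fun i _ => Real.rpow_nonneg (hρ.eigenvalues_nonneg i) _

theorem schatten_smul {n : ℕ} {α c : ℝ} (hα : 0 < α) (hc : 0 ≤ c)
    {ρ : Matrix (Fin n) (Fin n) ℂ} (hρ : ρ.PosSemidef) :
    schatten α ((c : ℂ) • ρ) = c * schatten α ρ := by
  have h : traceFun (fun x => (c * x) ^ α) ρ = c ^ α * traceFun (fun x => x ^ α) ρ := by
    rw [traceFun_eq_sum _ hρ.isHermitian, traceFun_eq_sum _ hρ.isHermitian, Finset.mul_sum]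
    exact Finset.sum_congr rfl fun i _ => Real.mul_rpow hc (hρ.eigenvalues_nonneg i)
  rw [schatten, traceFun_smul _ _ hρ.isHermitian, h, Real.mul_rpow (Real.rpow_nonneg hc _)
    (traceFun_rpow_nonneg α hρ), ← Real.rpow_mul hc, mul_one_div_cancel hα.ne', Real.rpow_one,
    schatten]

theorem schatten_mul_conjTranspose_comm {m n : ℕ} {α : ℝ} (hα : 0 < α)
    (W : Matrix (Fin m) (Fin n) ℂ) : schatten α (W * Wᴴ) = schatten α (Wᴴ * W) := by
  rw [schatten, schatten,
    traceFun_mul_conjTranspose_comm (f := fun x => x ^ α) (Real.zero_rpow hα.ne')]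

/-- Minkowski's inequality in an eigenbasis of `ρ + σ`, then Peierls' inequality for the concave
function `-x^α`. -/
theorem schatten_add_le {n : ℕ} {α : ℝ} (hα : 1 < α) {ρ σ : Matrix (Fin n) (Fin n) ℂ}
    (hρ : ρ.PosSemidef) (hσ : σ.PosSemidef) :
    schatten α (ρ + σ) ≤ schatten α ρ + schatten α σ := by
  obtain ⟨x, y, hx, hy, -, -, hadd, hle⟩ := exists_diag_add hρ hσ
  have h := hle (fun x => -x ^ α) (convexOn_rpow hα.le).neg
  have hneg {τ : Matrix (Fin n) (Fin n) ℂ} (hτ : τ.PosSemidef) :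
      traceFun (fun x => -x ^ α) τ = -traceFun (fun x => x ^ α) τ := by
    rw [traceFun_eq_sum _ hτ.isHermitian, traceFun_eq_sum _ hτ.isHermitian,
      Finset.sum_neg_distrib]
  rw [hneg hρ, hneg hσ, Finset.sum_neg_distrib, Finset.sum_neg_distrib, neg_le_neg_iff,
    neg_le_neg_iff] at h
  have h0 : 0 ≤ 1 / α := by positivity
  rw [schatten, hadd]
  refine (Real.Lp_add_le_of_nonneg Finset.univ hα.le (fun i _ => hx i) fun i _ => hy i).trans ?_
  exact add_le_add
    (Real.rpow_le_rpow (Finset.sum_nonneg fun i _ => Real.rpow_nonneg (hx i) _) h.1 h0)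
    (Real.rpow_le_rpow (Finset.sum_nonneg fun i _ => Real.rpow_nonneg (hy i) _) h.2 h0)

/-- Minkowski's inequality, for a sum of vectors with two components. -/
theorem rpow_sum_add_rpow_sum_le {ι : Type*} (s : Finset ι) {q : ℝ} (hq : 1 ≤ q) {x y : ι → ℝ}
    (hx : ∀ i, 0 ≤ x i) (hy : ∀ i, 0 ≤ y i) :
    ((∑ i ∈ s, x i) ^ q + (∑ i ∈ s, y i) ^ q) ^ (1 / q) ≤
      ∑ i ∈ s, (x i ^ q + y i ^ q) ^ (1 / q) := by
  classical
  induction s using Finset.induction_on with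
  | empty =>
    have hq0 : q ≠ 0 := by positivity
    simp [Real.zero_rpow hq0, Real.zero_rpow (inv_ne_zero hq0)]
  | insert k s hk ih =>
    simp only [Finset.sum_insert hk]
    have h := Real.Lp_add_le_of_nonneg (Finset.univ : Finset (Fin 2)) hq
      (f := ![x k, y k]) (g := ![∑ i ∈ s, x i, ∑ i ∈ s, y i])
      (by simp [Fin.forall_fin_two, hx, hy])
      (by simp [Fin.forall_fin_two, Finset.sum_nonneg, hx, hy])
    simp only [Fin.sum_univ_two, Matrix.cons_val_zero, Matrix.cons_val_one] at h
    exact h.trans (add_le_add_right ih _)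

/-- The reverse Minkowski inequality. -/
theorem add_rpow_sum_le {ι : Type*} (s : Finset ι) {α : ℝ} (hα : 0 < α) (hα1 : α ≤ 1)
    {x y : ι → ℝ} (hx : ∀ i, 0 ≤ x i) (hy : ∀ i, 0 ≤ y i) :
    (∑ i ∈ s, x i ^ α) ^ (1 / α) + (∑ i ∈ s, y i ^ α) ^ (1 / α) ≤
      (∑ i ∈ s, (x i + y i) ^ α) ^ (1 / α) := by
  -- Minkowski with exponent `1 / α ≥ 1` for the pairs `(x i ^ α, y i ^ α)`.
  have h := rpow_sum_add_rpow_sum_le s ((one_le_div hα).2 hα1)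
    (fun i => Real.rpow_nonneg (hx i) α) (fun i => Real.rpow_nonneg (hy i) α)
  have hroot {z : ℝ} (hz : 0 ≤ z) : (z ^ α) ^ (1 / α) = z := by
    rw [← Real.rpow_mul hz, mul_one_div_cancel hα.ne', Real.rpow_one]
  simp only [hroot (hx _), hroot (hy _), one_div_one_div] at h
  have hX := Real.rpow_nonneg (Finset.sum_nonneg fun i (_ : i ∈ s) => Real.rpow_nonneg (hx i) α)
    (1 / α)
  have hY := Real.rpow_nonneg (Finset.sum_nonneg fun i (_ : i ∈ s) => Real.rpow_nonneg (hy i) α)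
    (1 / α)
  have h2 := Real.rpow_le_rpow (Real.rpow_nonneg (add_nonneg hX hY) _) h (one_div_pos.2 hα).le
  rwa [hroot (add_nonneg hX hY)] at h2

theorem le_schatten_add {n : ℕ} {α : ℝ} (hα : 0 < α) (hα1 : α < 1)
    {ρ σ : Matrix (Fin n) (Fin n) ℂ} (hρ : ρ.PosSemidef) (hσ : σ.PosSemidef) :
    schatten α ρ + schatten α σ ≤ schatten α (ρ + σ) := by
  obtain ⟨x, y, hx, hy, -, -, hadd, hle⟩ := exists_diag_add hρ hσ
  have h := hle (fun x => x ^ α) (Real.concaveOn_rpow hα.le hα1.le)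
  have h0 : 0 ≤ 1 / α := by positivity
  rw [schatten, schatten, schatten, hadd]
  exact (add_le_add (Real.rpow_le_rpow (traceFun_rpow_nonneg α hρ) h.1 h0)
    (Real.rpow_le_rpow (traceFun_rpow_nonneg α hσ) h.2 h0)).trans
    (add_rpow_sum_le _ hα hα1.le hx hy)

theorem isConcaveMonotone_schatten {α : ℝ} (hα : 0 < α) (hα1 : α < 1) :
    IsConcaveMonotone fun _ ρ => schatten α ρ where
  smul hc hρ := schatten_smul hα hc hρ
  add hρ hσ := le_schatten_add hα hα1 hρ hσ
  comm W := schatten_mul_conjTranspose_comm hα W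

theorem isConcaveMonotone_neg_schatten {α : ℝ} (hα : 1 < α) :
    IsConcaveMonotone fun _ ρ => -schatten α ρ where
  smul hc hρ := by rw [schatten_smul (by positivity) hc hρ, mul_neg]
  add hρ hσ := by
    have := schatten_add_le hα hρ hσ
    linarith
  comm W := by rw [schatten_mul_conjTranspose_comm (by positivity)]

/-- The homogeneous extension of the von Neumann entropy to positive semidefinite matrices. -/
noncomputable def homEntropy {n : ℕ} (ρ : Matrix (Fin n) (Fin n) ℂ) : ℝ :=
  traceFun Real.negMulLog ρ - Real.negMulLog ρ.trace.re

theorem homEntropy_smul {n : ℕ} {c : ℝ} {ρ : Matrix (Fin n) (Fin n) ℂ} (hρ : ρ.PosSemidef) :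
    homEntropy ((c : ℂ) • ρ) = c * homEntropy ρ := by
  have h : traceFun (fun x => Real.negMulLog (c * x)) ρ =
      ρ.trace.re * Real.negMulLog c + c * traceFun Real.negMulLog ρ := by
    rw [traceFun_eq_sum _ hρ.isHermitian, traceFun_eq_sum _ hρ.isHermitian,
      trace_re_eq_sum_eigenvalues hρ.isHermitian, Finset.mul_sum, Finset.sum_mul,
      ← Finset.sum_add_distrib]
    exact Finset.sum_congr rfl fun i _ => Real.negMulLog_mul _ _
  rw [homEntropy, traceFun_smul _ _ hρ.isHermitian, h, Matrix.trace_smul, smul_eq_mul,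
    Complex.re_ofReal_mul, Real.negMulLog_mul, homEntropy]
  ring

/-- This is `log z ≤ z - 1` at `z = S X / (x T)`, times `x`. With `X = x + y` and `T = S + R`, the
error `S * (X / T) - x` cancels against its counterpart for `y` and `R`. -/
theorem negMulLog_add_mul_log_le {x X S T : ℝ} (hx : 0 ≤ x) (hxX : x ≤ X) (hS : x ≤ S)
    (hST : S ≤ T) : Real.negMulLog x + x * Real.log S ≤
      x * (Real.log T - Real.log X) + (S * (X / T) - x) := by
  rcases hx.eq_or_lt with rfl | hx
  · have : 0 ≤ S * (X / T) := mul_nonneg hS (div_nonneg hxX (hS.trans hST))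
    simpa using this
  have hX := hx.trans_le hxX
  have hS := hx.trans_le hS
  have hT := hS.trans_le hST
  have h := Real.log_le_sub_one_of_pos (x := S * X / (x * T)) (by positivity)
  rw [Real.log_div (by positivity) (by positivity), Real.log_mul hS.ne' hX.ne',
    Real.log_mul hx.ne' hT.ne'] at h
  have h2 := mul_le_mul_of_nonneg_left h hx.le
  have h3 : x * (S * X / (x * T) - 1) = S * (X / T) - x := by field_simp
  rw [h3] at h2
  rw [Real.negMulLog]
  linarith

theorem sum_negMulLog_sub_add_le {ι : Type*} [Fintype ι] {x y : ι → ℝ} (hx : ∀ i, 0 ≤ x i)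
    (hy : ∀ i, 0 ≤ y i) :
    (∑ i, Real.negMulLog (x i) - Real.negMulLog (∑ i, x i)) +
      (∑ i, Real.negMulLog (y i) - Real.negMulLog (∑ i, y i)) ≤
      ∑ i, Real.negMulLog (x i + y i) - Real.negMulLog (∑ i, x i + ∑ i, y i) := by
  set S := ∑ i, x i with hS
  set R := ∑ i, y i with hR
  have hS0 : 0 ≤ S := Finset.sum_nonneg fun i _ => hx i
  have hR0 : 0 ≤ R := Finset.sum_nonneg fun i _ => hy i
  have hexp {z : ι → ℝ} {Z : ℝ} (hZ : Z = ∑ i, z i) :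
      ∑ i, Real.negMulLog (z i) - Real.negMulLog Z =
        ∑ i, (Real.negMulLog (z i) + z i * Real.log Z) := by
    rw [Finset.sum_add_distrib, ← Finset.sum_mul, ← hZ, Real.negMulLog]
    ring
  rw [hexp hS, hexp hR, hexp (z := fun i => x i + y i)
    (by rw [Finset.sum_add_distrib]), ← Finset.sum_add_distrib]
  refine Finset.sum_le_sum fun i _ => ?_
  have hxS : x i ≤ S := Finset.single_le_sum (fun i _ => hx i) (Finset.mem_univ i)
  have hyR : y i ≤ R := Finset.single_le_sum (fun i _ => hy i) (Finset.mem_univ i)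
  have h1 := negMulLog_add_mul_log_le (X := x i + y i) (T := S + R) (hx i)
    (le_add_of_nonneg_right (hy i)) hxS (le_add_of_nonneg_right hR0)
  have h2 := negMulLog_add_mul_log_le (X := x i + y i) (T := S + R) (hy i)
    (le_add_of_nonneg_left (hx i)) hyR (le_add_of_nonneg_left hS0)
  have h3 : S * ((x i + y i) / (S + R)) + R * ((x i + y i) / (S + R)) = x i + y i := by
    rcases eq_or_ne (S + R) 0 with h0 | h0
    · have := hx i
      have := hy i
      have : x i + y i = 0 := by linarith
      simp [this]
    · field_simp
  have h4 : Real.negMulLog (x i + y i) = -(x i + y i) * Real.log (x i + y i) := rfl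
  rw [h4]
  linarith

theorem isConcaveMonotone_homEntropy : IsConcaveMonotone fun _ ρ => homEntropy ρ where
  smul _ hρ := homEntropy_smul hρ
  add {n ρ σ} hρ hσ := by
    obtain ⟨x, y, hx, hy, hxt, hyt, hadd, hle⟩ := exists_diag_add hρ hσ
    have h := hle _ Real.concaveOn_negMulLog
    rw [homEntropy, homEntropy, homEntropy, hadd, Matrix.trace_add, Complex.add_re, ← hxt, ← hyt]
    have := sum_negMulLog_sub_add_le hx hy
    linarith
  comm W := by
    rw [homEntropy, homEntropy, traceFun_mul_conjTranspose_comm Real.negMulLog_zero,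
      Matrix.trace_mul_comm]

end Monotones

/-! ### Optimality of `s = 1 / α`. -/

theorem mul_le_of_mem_Omega {α s : ℝ} (h : (α, s) ∈ Omega) : s * (1 - α) ≤ 1 / α * (1 - α) := by
  rcases h with ⟨-, h1, h2⟩ | ⟨h1, h2⟩
  · exact mul_le_mul_of_nonneg_right h2 (sub_nonneg.2 h1.le)
  · exact mul_le_mul_of_nonpos_right h2 (sub_nonpos.2 h1.le)

theorem ne_one_of_mem_Omega {α s : ℝ} (h : (α, s) ∈ Omega) : α ≠ 1 := by
  rcases h with ⟨-, h1, -⟩ | ⟨h1, -⟩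
  exacts [h1.ne, h1.ne']

theorem mem_Omega_one_div {α : ℝ} (hα : 0 < α) (hα1 : α ≠ 1) : (α, 1 / α) ∈ Omega :=
  hα1.lt_or_gt.imp (fun h => ⟨hα, h, le_rfl⟩) fun h => ⟨h, le_rfl⟩

theorem entBound_le_entBound_one_div {ι : Type*} [Fintype ι] {p x : ι → ℝ}
    (hp : ∀ m, 0 ≤ p m) (hp1 : ∑ m, p m = 1) {α s : ℝ} (h : (α, s) ∈ Omega) :
    entBound p x α s ≤ entBound p x α (1 / α) := by
  rw [entBound_eq_expMean (ne_one_of_mem_Omega h), entBound_eq_expMean (ne_one_of_mem_Omega h)]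
  exact monotone_expMean hp hp1 (mul_le_of_mem_Omega h)

/-! ### The bounds for `γ = α`. -/

section Bounds

variable {ι : Type*} [Fintype ι] [DecidableEq ι] {a b a' b' : ℕ} {Ψ : PureState a b} {p : ι → ℝ}
  {Φ : ι → PureState a' b'}

theorem PureState.traceFun_rpow_pos (Ψ : PureState a b) (α : ℝ) :
    0 < traceFun (fun x => x ^ α) Ψ.reducedB := by
  have h0 := Ψ.posSemidef_reducedB.eigenvalues_nonneg
  obtain ⟨i, -, hi⟩ := Finset.exists_ne_zero_of_sum_ne_zero
    (Ψ.sum_eigenvalues.trans_ne one_ne_zero)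
  rw [traceFun_eq_sum _ Ψ.posSemidef_reducedB.isHermitian]
  exact Finset.sum_pos' (fun i _ => Real.rpow_nonneg (h0 i) _)
    ⟨i, Finset.mem_univ i, Real.rpow_pos_of_pos ((h0 i).lt_of_ne hi.symm) _⟩

theorem PureState.schatten_pos (Ψ : PureState a b) (α : ℝ) : 0 < schatten α Ψ.reducedB :=
  Real.rpow_pos_of_pos (Ψ.traceFun_rpow_pos α) _

theorem REE_eq_log_schatten (Ψ : PureState a b) {α : ℝ} (hα : 0 < α) (hα1 : α ≠ 1) :
    REE α Ψ = 1 / (1 / α * (1 - α)) * Real.log (schatten α Ψ.reducedB) := by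
  have h1 : 1 - α ≠ 0 := sub_ne_zero.2 hα1.symm
  rw [schatten, Real.log_rpow (Ψ.traceFun_rpow_pos α), REE, renyiEntropy, if_neg hα1, traceFun]
  field_simp

theorem exp_mul_REE (Ψ : PureState a b) {α : ℝ} (hα : 0 < α) (hα1 : α ≠ 1) :
    Real.exp (1 / α * (1 - α) * REE α Ψ) = schatten α Ψ.reducedB := by
  have h1 : 1 - α ≠ 0 := sub_ne_zero.2 hα1.symm
  rw [REE_eq_log_schatten Ψ hα hα1, ← mul_assoc, mul_one_div_cancel (by positivity), one_mul,
    Real.exp_log (Ψ.schatten_pos α)]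

theorem expMean_REE_le (h : Transforms Ψ p Φ) {α : ℝ} (hα : 0 < α) (hα1 : α ≠ 1) :
    expMean p (fun m => REE α (Φ m)) (1 / α * (1 - α)) ≤ REE α Ψ := by
  have h1 : 1 - α ≠ 0 := sub_ne_zero.2 hα1.symm
  rw [expMean_of_ne (by positivity), REE_eq_log_schatten Ψ hα hα1]
  simp only [exp_mul_REE _ hα hα1]
  have hpos := mean_pos h.nonneg h.sum_eq_one fun m => (Φ m).schatten_pos α
  rcases hα1.lt_or_gt with hlt | hgt
  · have : 0 < 1 - α := sub_pos.2 hlt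
    exact mul_le_mul_of_nonneg_left
      (Real.log_le_log hpos ((isConcaveMonotone_schatten hα hlt).mean_le h)) (by positivity)
  · have hle := (isConcaveMonotone_neg_schatten hgt).mean_le h
    simp only [mean, mul_neg, Finset.sum_neg_distrib, neg_le_neg_iff] at hle
    -- For `α > 1` the mean quasi-norm is at least the initial one, and the negative prefactor
    -- reverses the inequality.
    refine mul_le_mul_of_nonpos_left (Real.log_le_log (Ψ.schatten_pos α) hle) ?_
    exact one_div_nonpos.2 (mul_nonpos_of_nonneg_of_nonpos (by positivity) (by linarith))

theorem mean_REE_one_le (h : Transforms Ψ p Φ) :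
    mean p (fun m => REE 1 (Φ m)) ≤ REE 1 Ψ := by
  -- The correction term vanishes at trace one.
  have h1 {a b : ℕ} (Ψ : PureState a b) : homEntropy Ψ.reducedB = REE 1 Ψ := by
    simp [homEntropy, PureState.trace_reducedB, REE, renyiEntropy, traceFun]
  simpa only [h1] using isConcaveMonotone_homEntropy.mean_le h

end Bounds

end SLOCC

theorem proposition3 {ι : Type*} [Fintype ι] [DecidableEq ι] {a b a' b' : ℕ}
    (Ψ : SLOCC.PureState a b) (p : ι → ℝ) (Φ : ι → SLOCC.PureState a' b')
    (h : SLOCC.Transforms Ψ p Φ) (α γ : ℝ) (hα : 0 < α) (hαγ : α ≤ γ) :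
    -- the lower bound on the initial entanglement, for every admissible `s`
    (∀ s : ℝ, (α, s) ∈ SLOCC.Omega →
      SLOCC.entBound p (fun m => SLOCC.REE γ (Φ m)) α s ≤ SLOCC.REE α Ψ) ∧
    -- among the admissible `s`, the bound is maximal at `s = 1 / α`
    (α ≠ 1 → (α, 1 / α) ∈ SLOCC.Omega ∧
      IsMaxOn (fun s : ℝ => SLOCC.entBound p (fun m => SLOCC.REE γ (Φ m)) α s)
        {s : ℝ | (α, s) ∈ SLOCC.Omega} (1 / α)) ∧
    -- the limiting form of the bound at `α = 1`
    (α = 1 → SLOCC.mean p (fun m => SLOCC.REE γ (Φ m)) ≤ SLOCC.REE α Ψ) := by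
  refine ⟨fun s hs => ?_, fun hα1 => ⟨SLOCC.mem_Omega_one_div hα hα1, fun s hs =>
    SLOCC.entBound_le_entBound_one_div h.nonneg h.sum_eq_one hs⟩, ?_⟩
  -- Pass to `s = 1 / α`, then replace `E_γ` by the larger `E_α`.
  · refine (SLOCC.entBound_le_entBound_one_div h.nonneg h.sum_eq_one hs).trans ?_
    rw [SLOCC.entBound_eq_expMean (SLOCC.ne_one_of_mem_Omega hs)]
    exact (SLOCC.expMean_mono h.nonneg h.sum_eq_one (fun m => SLOCC.REE_anti (Φ m) hα hαγ) _).trans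
      (SLOCC.expMean_REE_le h hα (SLOCC.ne_one_of_mem_Omega hs))
  · rintro rfl
    exact (SLOCC.mean_mono h.nonneg fun m => SLOCC.REE_anti (Φ m) hα hαγ).trans
      (SLOCC.mean_REE_one_le h)
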